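/- Let $\mu$ be the unique Borel probability measure on $\mathbb{R}$ with $\mu(E)=\frac12\left(\mu(\tau_0^{-1}E)+\mu(\tau_2^{-1}E)\right)$ for all Borel sets $E\subseteq\mathbb{R}$, where $\tau_0(x)=\frac x4$ and $\tau_2(x)=\frac{x+2}4$; equivalently, $\mu$ is the law of $\sum_{k\ge1}4^{-k}b_k$ with independent digits $b_k$ uniform on $\{0,2\}$. For an odd number $m\in\mathbb{N}$ put $$\Gamma(m)=\left\{\sum_{k=0}^n4^kl_k : l_k\in\{0,m\},\ n\in\mathbb{N}\right\}.$$ Call $m$ complete if the functions $e_\lambda(x)=e^{2\pi i\lambda x}$, $\lambda\in\Gamma(m)$, form an orthonormal basis of $L^2(\mu)$, and incomplete otherwise. Call $m$ primitive if $m$ is incomplete and every proper divisor $d$ of $m$ (that is, every positive divisor $d\neq m$) is complete. Let $o_4(m)$ be the order of $4$ in the group of units of $\mathbb{Z}/m\mathbb{Z}$, that is, the smallest positive integer $k$ with $4^k\equiv1\pmod m$. Let $a,b\ge1$ be odd numbers with $$o_4(ab)>2^{\left\lceil\log_2\sqrt{a/3}\right\rceil}\,o_4(b).$$ Then $ab$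 is not primitive. -/

import Mathlib

open MeasureTheory
open scoped ENNReal

namespace CantorSpectra

noncomputable section

/-! ### The invariant measure of the quarter Cantor set -/

/-- The uniform probability measure on the two base-4 digits `0` and `2`. -/
def digitMeasure : Measure (Fin 4) :=
  (2⁻¹ : ℝ≥0∞) • (Measure.dirac 0 + Measure.dirac 2)

instance : IsProbabilityMeasure digitMeasure := by
  constructor
  simp only [digitMeasure, Measure.smul_apply, Measure.add_apply, measure_univ, smul_eq_mul]
  rw [one_add_one_eq_two]
  exact ENNReal.inv_mul_cancel (by norm_num) (by norm_num)

/-- The law of an infinite sequence of independent digits, each uniform on `{0, 2}`. -/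
def digitSeqMeasure : Measure (ℕ → Fin 4) :=
  Measure.infinitePi fun _ : ℕ => digitMeasure

instance : IsProbabilityMeasure digitSeqMeasure := by
  unfold digitSeqMeasure; infer_instance

/-- The measure `μ` on the Cantor set `X₄ = {∑_{k ≥ 1} b_k 4^{-k} : b_k ∈ {0, 2}}`: the law of
`∑_{k ≥ 1} b_k 4^{-k}` for independent digits `b_k`, each uniform on `{0, 2}`
(`Real.ofDigits d = ∑_{k ≥ 0} d k * 4^{-(k+1)}`). It is a Borel probability measure that satisfies
the invariance equation of the maps `x ↦ x / 4` and `x ↦ (x + 2) / 4`, which is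
`cantorMeasure_invariant` below; only one Borel probability measure does. -/
def cantorMeasure : Measure ℝ :=
  digitSeqMeasure.map Real.ofDigits

lemma measurable_ofDigits : Measurable (Real.ofDigits : (ℕ → Fin 4) → ℝ) :=
  Real.continuous_ofDigits.measurable

instance : IsProbabilityMeasure cantorMeasure :=
  Measure.isProbabilityMeasure_map measurable_ofDigits.aemeasurable

/-- The sequence `d 0, d 1, …` preceded by the digit `c`. -/
def consDigit (c : Fin 4) (d : ℕ → Fin 4) : ℕ → Fin 4
  | 0 => c
  | n + 1 => d n

lemma measurable_consDigit (c : Fin 4) : Measurable (consDigit c) := by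
  refine measurable_pi_iff.2 fun n => ?_
  cases n with
  | zero => exact measurable_const
  | succ n => exact measurable_pi_apply n

lemma ofDigits_consDigit (c : Fin 4) (d : ℕ → Fin 4) :
    Real.ofDigits (consDigit c d) = (Real.ofDigits d + ((c : ℕ) : ℝ)) / 4 := by
  rw [Real.ofDigits_eq_sum_add_ofDigits _ 1]
  have h : (fun i => consDigit c d (i + 1)) = d := rfl
  simp only [Finset.sum_range_one, Real.ofDigitsTerm, h]
  simp only [consDigit]
  norm_num
  ring

lemma digitSeqMeasure_eq :
    digitSeqMeasure = (2⁻¹ : ℝ≥0∞) •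
      (digitSeqMeasure.map (consDigit 0) + digitSeqMeasure.map (consDigit 2)) := by
  symm
  refine Measure.eq_infinitePi _ fun s t ht => ?_
  classical
  obtain ⟨N, hN⟩ : ∃ N : ℕ, ∀ i ∈ s, i < N + 1 :=
    ⟨s.sup id, fun i hi => Nat.lt_succ_of_le (Finset.le_sup (f := id) hi)⟩
  set u : ℕ → Set (Fin 4) := fun i => if i ∈ s then t i else Set.univ with hu
  have hset : Set.pi (s : Set ℕ) t = Set.pi (Finset.range (N + 1) : Set ℕ) u := by
    ext d
    simp only [Set.mem_pi, Finset.mem_coe, Finset.mem_range, hu]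
    refine ⟨fun H i _ => ?_, fun H i hi => ?_⟩
    · split_ifs with hi
      · exact H i hi
      · trivial
    · have := H i (hN i hi)
      rwa [if_pos hi] at this
  have hprod : ∏ i ∈ s, digitMeasure (t i) = ∏ i ∈ Finset.range (N + 1), digitMeasure (u i) := by
    rw [← Finset.prod_subset (s₁ := s) (fun i hi => Finset.mem_range.2 (hN i hi))]
    · exact Finset.prod_congr rfl fun i hi => by simp [hu, hi]
    · intro i _ hi
      simp [hu, hi]
  have hmeas : MeasurableSet (Set.pi (Finset.range (N + 1) : Set ℕ) u) :=
    MeasurableSet.pi (Finset.countable_toSet _) fun i _ => MeasurableSet.of_discrete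
  have key (c : Fin 4) : digitSeqMeasure.map (consDigit c)
      (Set.pi (Finset.range (N + 1) : Set ℕ) u) =
      Measure.dirac c (u 0) * ∏ i ∈ Finset.range N, digitMeasure (u (i + 1)) := by
    rw [Measure.map_apply (measurable_consDigit c) hmeas]
    have hpre : consDigit c ⁻¹' Set.pi (Finset.range (N + 1) : Set ℕ) u =
        {d | c ∈ u 0 ∧ d ∈ Set.pi (Finset.range N : Set ℕ) fun i => u (i + 1)} := by
      ext d
      simp only [Set.mem_preimage, Set.mem_pi, Finset.mem_coe, Finset.mem_range, Set.mem_ofPred_eq]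
      refine ⟨fun H => ⟨H 0 (by omega), fun i hi => H (i + 1) (by omega)⟩, fun H i hi => ?_⟩
      cases i with
      | zero => exact H.1
      | succ i => exact H.2 i (by omega)
    rw [hpre, Measure.dirac_apply' _ MeasurableSet.of_discrete]
    by_cases hc : c ∈ u 0
    · simp only [hc, true_and, Set.ofPred_mem_eq, Set.indicator_of_mem, Pi.one_apply, one_mul]
      exact Measure.infinitePi_pi _ fun i _ => MeasurableSet.of_discrete
    · simp [hc]
  rw [hset, hprod, Finset.prod_range_succ', Measure.smul_apply, Measure.add_apply, key, key,
    smul_eq_mul, ← add_mul, ← mul_assoc, mul_comm]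
  rfl

/-- The invariance equation that characterizes `cantorMeasure`. -/
theorem cantorMeasure_invariant (E : Set ℝ) (hE : MeasurableSet E) :
    cantorMeasure E = 2⁻¹ * (cantorMeasure ((fun x => x / 4) ⁻¹' E) +
      cantorMeasure ((fun x => (x + 2) / 4) ⁻¹' E)) := by
  have h0 : MeasurableSet ((fun x : ℝ => x / 4) ⁻¹' E) :=
    (by fun_prop : Measurable fun x : ℝ => x / 4) hE
  have h2 : MeasurableSet ((fun x : ℝ => (x + 2) / 4) ⁻¹' E) :=
    (by fun_prop : Measurable fun x : ℝ => (x + 2) / 4) hE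
  have hp := measurable_ofDigits hE
  rw [cantorMeasure, Measure.map_apply measurable_ofDigits hE,
    Measure.map_apply measurable_ofDigits h0, Measure.map_apply measurable_ofDigits h2]
  conv_lhs => rw [digitSeqMeasure_eq]
  rw [Measure.smul_apply, Measure.add_apply, Measure.map_apply (measurable_consDigit 0) hp,
    Measure.map_apply (measurable_consDigit 2) hp, smul_eq_mul]
  congr 3
  · ext d
    simp [ofDigits_consDigit]
  · ext d
    simp [ofDigits_consDigit]

/-! ### Spectra, complete and primitive numbers -/

/-- `Γ` is a spectrum for `μ`: the functions `e_l(x) = exp (2 π i l x)`, `l ∈ Γ`, form an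
orthonormal (Hilbert) basis of `L²(μ)`. -/
def IsSpectrum (μ : Measure ℝ) (Γ : Set ℝ) : Prop :=
  ∃ e : HilbertBasis Γ ℂ (Lp ℂ 2 μ), ∀ l : Γ,
    (e l : ℝ → ℂ) =ᵐ[μ] fun x => Complex.exp (2 * Real.pi * Complex.I * ((l : ℝ) * x : ℝ))

/-- `Γ(m) = {∑_{k=0}^n 4^k l_k : l_k ∈ {0, m}, n ∈ ℕ}`. -/
def Gam (m : ℕ) : Set ℝ :=
  {x | ∃ (n : ℕ) (l : ℕ → ℝ), (∀ k, l k = 0 ∨ l k = m) ∧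
    x = ∑ k ∈ Finset.range (n + 1), 4 ^ k * l k}

/-- A number `m` (odd, in all uses) is complete if `Γ(m)` is a spectrum for the measure `μ`. -/
def IsComplete (m : ℕ) : Prop :=
  IsSpectrum cantorMeasure (Gam m)

/-- An odd number `m` is primitive if it is incomplete and all its proper divisors are complete. -/
def IsPrimitive (m : ℕ) : Prop :=
  Odd m ∧ ¬ IsComplete m ∧ ∀ d ∈ m.properDivisors, IsComplete d

/-- `o₄(m)`, the order of `4` modulo `m` (for odd `m` the least `k ≥ 1` with `4 ^ k ≡ 1 mod m`). -/
def o4 (m : ℕ) : ℕ :=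
  orderOf (4 : ZMod m)

end

end CantorSpectra

/-! Put m = ab. Incompleteness of m is equivalent to an arithmetic fact: some orbit of positive
integers satisfies 4x_{k+1} = x_k or x_k + m. Given such an orbit, e_{-x} is orthogonal to every e_λ
with λ in Γ(m), because -x - λ is always a zero of the transform (`SuccClosed.not_isComplete`).
Conversely, if m is incomplete, the sum of |μ̂(t + λ)|² over Γ(m) drops below 1 somewhere, and its
minimisers on a suitable interval yield the orbit (`exists_succClosed`).

If m is primitive, the orbit is coprime to m: a common factor could be divided out
(`SuccClosed.div_gcd`), making a proper divisor incomplete. Since x_k = 4^{-k} x_0 modulo m, the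
first o_4(m) terms are then distinct. But x_k modulo b depends only on k modulo o_4(b), and x_k
modulo 4^n only on the next n binary choices. If a ≤ 3·4^n, an orbit inside (0, m/3] is determined
by these two residues, so o_4(ab) ≤ 2^n o_4(b) (`o4_mul_le`). The rounded logarithm in the
hypothesis provides such an n. -/

namespace CantorSpectra

/-! ### Moser–de Bruijn numbers and the set Γ(m) -/

/-- The Moser–de Bruijn sequence: the binary digits of `n` read in base `4`. -/
def moser (n : ℕ) : ℕ := Nat.ofDigits 4 (Nat.digits 2 n)

@[simp] lemma moser_zero : moser 0 = 0 := by simp [moser]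

lemma moser_two_mul_add_one (n : ℕ) : moser (2 * n + 1) = 4 * moser n + 1 := by
  have : 2 * n + 1 = 1 + 2 * n := by ring
  rw [moser, this, Nat.digits_add 2 (by norm_num) 1 n (by norm_num) (by simp), Nat.ofDigits_cons,
    moser]
  ring

lemma moser_two_mul (n : ℕ) : moser (2 * n) = 4 * moser n := by
  rcases Nat.eq_zero_or_pos n with rfl | hn
  · simp
  · have : 2 * n = 0 + 2 * n := by ring
    rw [moser, this, Nat.digits_add 2 (by norm_num) 0 n (by norm_num) (Or.inr hn.ne'),
      Nat.ofDigits_cons, moser]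
    ring

/-- Common low binary digits contribute a power of 4; at the first differing digit the rest is ±1
modulo 4. Such differences are zeros of `cantorFourier`, whence orthogonality. -/
lemma moser_diff {n n' : ℕ} (h : n ≠ n') :
    ∃ (k : ℕ) (j : ℤ), Odd j ∧ (moser n : ℤ) - moser n' = 4 ^ k * j := by
  induction n using Nat.strong_induction_on generalizing n' with
  | _ n ih =>
    obtain ⟨p, hp | hp⟩ := Nat.even_or_odd' n <;> obtain ⟨q, hq | hq⟩ := Nat.even_or_odd' n'
    · have hp0 : p < n ∨ n = 0 := by omega
      rcases hp0 with hlt | h0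
      · obtain ⟨k, j, hj, e⟩ := ih p hlt (n' := q) (by omega)
        refine ⟨k + 1, j, hj, ?_⟩
        rw [hp, hq, moser_two_mul, moser_two_mul, pow_succ]
        push_cast; linear_combination 4 * e
      -- Halving does not decrease n = 0, so the descent is on n' here.
      · obtain ⟨k, j, hj, e⟩ : ∃ (k : ℕ) (j : ℤ), Odd j ∧ (moser n' : ℤ) = 4 ^ k * j := by
          clear ih hq q hp p
          have hn' : 0 < n' := by omega
          clear h h0 n
          induction n' using Nat.strong_induction_on with
          | _ n' ih =>
            obtain ⟨q, hq | hq⟩ := Nat.even_or_odd' n'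
            · obtain ⟨k, j, hj, e⟩ := ih q (by omega) (by omega)
              refine ⟨k + 1, j, hj, ?_⟩
              rw [hq, moser_two_mul, pow_succ]
              push_cast; linear_combination 4 * e
            · refine ⟨0, 2 * (2 * moser q) + 1, ⟨_, rfl⟩, ?_⟩
              rw [hq, moser_two_mul_add_one]; push_cast; ring
        refine ⟨k, -j, hj.neg, ?_⟩
        rw [h0, moser_zero, e]; push_cast; ring
    · refine ⟨0, 2 * (2 * moser p - 2 * moser q - 1) + 1, ⟨_, rfl⟩, ?_⟩
      rw [hp, hq, moser_two_mul, moser_two_mul_add_one]; push_cast; ring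
    · refine ⟨0, 2 * (2 * moser p - 2 * moser q) + 1, ⟨_, rfl⟩, ?_⟩
      rw [hp, hq, moser_two_mul, moser_two_mul_add_one]; push_cast; ring
    · obtain ⟨k, j, hj, e⟩ := ih p (by omega) (n' := q) (by omega)
      refine ⟨k + 1, j, hj, ?_⟩
      rw [hp, hq, moser_two_mul_add_one, moser_two_mul_add_one, pow_succ]
      push_cast; linear_combination 4 * e

/-- Prepending a lowest digit 0 or m to a sum corresponds to j ↦ 2j or j ↦ 2j + 1. Indexing by ℕ
removes the ambiguity of leading zeros. -/
lemma Gam_eq_range (m : ℕ) : Gam m = Set.range fun n : ℕ => (m : ℝ) * moser n := by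
  have sums (n : ℕ) : ∀ l : ℕ → ℝ, (∀ k, l k = 0 ∨ l k = m) →
      ∃ j : ℕ, (m : ℝ) * moser j = ∑ k ∈ Finset.range n, 4 ^ k * l k := by
    induction n with
    | zero => exact fun l _ => ⟨0, by simp⟩
    | succ n ih =>
      intro l hl
      obtain ⟨j, hj⟩ := ih (fun k => l (k + 1)) fun k => hl _
      have hs : ∑ k ∈ Finset.range (n + 1), (4 : ℝ) ^ k * l k
          = 4 * ∑ k ∈ Finset.range n, 4 ^ k * l (k + 1) + l 0 := by
        rw [Finset.sum_range_succ', Finset.mul_sum]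
        simp only [pow_succ, pow_zero, one_mul]
        congr 1
        exact Finset.sum_congr rfl fun k _ => by ring
      rcases hl 0 with h0 | h0
      · exact ⟨2 * j, by rw [hs, ← hj, h0, moser_two_mul]; push_cast; ring⟩
      · exact ⟨2 * j + 1, by rw [hs, ← hj, h0, moser_two_mul_add_one]; push_cast; ring⟩
  have step (x c : ℝ) (hx : x ∈ Gam m) (hc : c = 0 ∨ c = m) : 4 * x + c ∈ Gam m := by
    obtain ⟨n, l, hl, rfl⟩ := hx
    refine ⟨n + 1, fun k => Nat.casesOn k c l, fun k => ?_, ?_⟩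
    · cases k with
      | zero => exact hc
      | succ k => exact hl k
    · rw [Finset.sum_range_succ' _ (n + 1), Finset.mul_sum]
      simp only [pow_succ, pow_zero, one_mul]
      congr 1
      exact Finset.sum_congr rfl fun k _ => by ring
  ext x
  constructor
  · rintro ⟨n, l, hl, rfl⟩
    exact sums (n + 1) l hl
  · rintro ⟨n, rfl⟩
    induction n using Nat.strong_induction_on with
    | _ n ih =>
      obtain ⟨p, hp | hp⟩ := Nat.even_or_odd' n
      · rcases Nat.eq_zero_or_pos n with rfl | hn
        · exact ⟨0, fun _ => 0, fun _ => Or.inl rfl, by simp⟩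
        · have := step _ 0 (ih p (by omega)) (Or.inl rfl)
          simp only [hp, moser_two_mul] at this ⊢
          convert this using 1; push_cast; ring
      · have := step _ m (ih p (by omega)) (Or.inr rfl)
        simp only [hp, moser_two_mul_add_one] at this ⊢
        convert this using 1; push_cast; ring

/-! ### Integer orbits of the maps x ↦ x/4 and x ↦ (x + m)/4 -/

/-- `S` is a set of positive integers that is closed under a choice of one of the maps
`x ↦ x / 4` and `x ↦ (x + m) / 4` at each point: a union of orbits leading into nontrivial
extreme cycles. -/
def SuccClosed (m : ℕ) (S : Set ℕ) : Prop :=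
  ∀ x ∈ S, 0 < x ∧ ∃ y ∈ S, 4 * y = x ∨ 4 * y = x + m

namespace SuccClosed

variable {m : ℕ} {S : Set ℕ}

/-- If the last binary digit of n matches the branch taken at x, a factor 4 comes out and a smaller
sum of the same shape remains; otherwise the sum is odd. Positivity of the points makes the descent
strict. -/
lemma add_moser (hm : Odd m) (hS : SuccClosed m S) {x : ℕ} (hx : x ∈ S) (n : ℕ) :
    ∃ (k : ℕ) (j : ℤ), Odd j ∧ (x : ℤ) + m * moser n = 4 ^ k * j := by
  induction h : x + m * moser n using Nat.strong_induction_on generalizing x n with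
  | _ N ih =>
    obtain ⟨hx0, y, hy, hxy⟩ := hS x hx
    have hy0 := (hS y hy).1
    obtain ⟨r, hr⟩ := hm
    obtain ⟨p, hp | hp⟩ := Nat.even_or_odd' n <;> rcases hxy with hxy | hxy
    · rw [hp, moser_two_mul] at h
      obtain ⟨k, j, hj, e⟩ := ih (y + m * moser p) (by
        have : m * (4 * moser p) = 4 * (m * moser p) := by ring
        omega) hy p rfl
      refine ⟨k + 1, j, hj, ?_⟩
      rw [hp, moser_two_mul, ← hxy, pow_succ]
      push_cast; linear_combination 4 * e
    · refine ⟨0, 2 * (2 * y + 2 * (m * moser p) - r - 1) + 1, ⟨_, rfl⟩, ?_⟩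
      have : (x : ℤ) = 4 * y - m := by omega
      rw [hp, moser_two_mul, this]
      push_cast [hr]; ring
    · refine ⟨0, 2 * (2 * y + 2 * (m * moser p) + r) + 1, ⟨_, rfl⟩, ?_⟩
      have : (x : ℤ) = 4 * y := by omega
      rw [hp, moser_two_mul_add_one, this]
      push_cast [hr]; ring
    · rw [hp, moser_two_mul_add_one] at h
      obtain ⟨k, j, hj, e⟩ := ih (y + m * moser p) (by
        have : m * (4 * moser p + 1) = 4 * (m * moser p) + m := by ring
        omega) hy p rfl
      refine ⟨k + 1, j, hj, ?_⟩
      have : (x : ℤ) = 4 * y - m := by omega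
      rw [hp, moser_two_mul_add_one, this, pow_succ]
      push_cast; linear_combination 4 * e

/-- The bits of j record the branches taken in n steps. Thus x has at most 2^n possible residues
modulo 4^n. -/
lemma exists_dvd_add_moser (hS : SuccClosed m S) (n : ℕ) {x : ℕ} (hx : x ∈ S) :
    ∃ j < 2 ^ n, 4 ^ n ∣ x + m * moser j := by
  induction n generalizing x with
  | zero => exact ⟨0, by simp⟩
  | succ n ih =>
    obtain ⟨-, y, hy, hxy⟩ := hS x hx
    obtain ⟨j, hj, q, hq⟩ := ih hy
    rcases hxy with hxy | hxy
    · refine ⟨2 * j, by rw [pow_succ]; omega, q, ?_⟩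
      rw [moser_two_mul, ← hxy, pow_succ]; linear_combination 4 * hq
    · refine ⟨2 * j + 1, by rw [pow_succ]; omega, q, ?_⟩
      rw [moser_two_mul_add_one, pow_succ]; linear_combination 4 * hq - hxy

/-- Start at the least element x₀: its successor y satisfies 4x₀ ≤ 4y ≤ x₀ + m, so 3x₀ ≤ m, and both
maps preserve this bound. -/
lemma exists_seq (hS : SuccClosed m S) (hne : S.Nonempty) :
    ∃ x : ℕ → ℕ, (∀ k, x k ∈ S) ∧ (∀ k, 3 * x k ≤ m) ∧
      ∀ k, 4 * x (k + 1) = x k ∨ 4 * x (k + 1) = x k + m := by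
  classical
  choose! f hf hf' using fun x hx => (hS x hx).2
  have hmin := Nat.sInf_mem hne
  set x₀ := sInf S
  have hmem (k : ℕ) : f^[k] x₀ ∈ S := by
    induction k with
    | zero => exact hmin
    | succ k ih => rw [Function.iterate_succ_apply']; exact hf _ ih
  have hstep (k : ℕ) : 4 * f^[k + 1] x₀ = f^[k] x₀ ∨ 4 * f^[k + 1] x₀ = f^[k] x₀ + m := by
    rw [Function.iterate_succ_apply']; exact hf' _ (hmem k)
  refine ⟨fun k => f^[k] x₀, hmem, fun k => ?_, hstep⟩
  induction k with
  | zero =>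
    have h1 : x₀ ≤ f x₀ := Nat.sInf_le (hf _ hmin)
    have := hf' _ hmin
    simp only [Function.iterate_zero, id]
    omega
  | succ k ih =>
    have := hstep k
    simp only at ih ⊢
    omega

/-- Common divisors with `m` propagate along the orbit, so they can be divided out. -/
lemma div_gcd (hm : Odd m) {x : ℕ → ℕ} (hx : ∀ k, 0 < x k)
    (hstep : ∀ k, 4 * x (k + 1) = x k ∨ 4 * x (k + 1) = x k + m) :
    SuccClosed (m / Nat.gcd (x 0) m) (Set.range fun k => x k / Nat.gcd (x 0) m) := by
  set g := Nat.gcd (x 0) m with hg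
  have hgm : g ∣ m := Nat.gcd_dvd_right _ _
  have hg0 : 0 < g := Nat.gcd_pos_of_pos_left _ (hx 0)
  have hcop : Nat.Coprime g 4 := by
    have : Nat.Coprime g 2 := (hm.of_dvd_nat hgm).coprime_two_right
    exact this.pow_right 2
  have hdvd (k : ℕ) : g ∣ x k := by
    induction k with
    | zero => exact Nat.gcd_dvd_left _ _
    | succ k ih =>
      refine hcop.dvd_of_dvd_mul_left ?_
      rcases hstep k with h | h <;> rw [h]
      · exact ih
      · exact dvd_add ih hgm
  obtain ⟨d, hd⟩ := hgm
  rintro _ ⟨k, rfl⟩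
  obtain ⟨u, hu⟩ := hdvd k
  obtain ⟨v, hv⟩ := hdvd (k + 1)
  have hk := hx k
  refine ⟨Nat.div_pos (Nat.le_of_dvd hk (hdvd k)) hg0, _, ⟨k + 1, rfl⟩, ?_⟩
  simp only
  rw [hu, hv, hd, Nat.mul_div_cancel_left _ hg0, Nat.mul_div_cancel_left _ hg0,
    Nat.mul_div_cancel_left _ hg0]
  rcases hstep k with h | h <;> rw [hu, hv] at h
  · exact Or.inl (Nat.eq_of_mul_eq_mul_left hg0 (by linarith))
  · exact Or.inr (Nat.eq_of_mul_eq_mul_left hg0 (by linarith))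

end SuccClosed

/-! ### Counting orbit points and the order of 4 -/

lemma coprime_four {m : ℕ} (hm : Odd m) : Nat.Coprime 4 m :=
  (hm.coprime_two_left).pow_left 2

/-- Along an orbit starting coprimely to `m = a * b`, the order of `4` modulo `m` is at most
`2 ^ n` times its order modulo `b`, if `4 ^ n ≥ a / 3`. -/
lemma o4_mul_le {a b n : ℕ} (hab : Odd (a * b)) {S : Set ℕ} (hS : SuccClosed (a * b) S)
    {x : ℕ → ℕ} (hmem : ∀ k, x k ∈ S) (hle : ∀ k, 3 * x k ≤ a * b)
    (hstep : ∀ k, 4 * x (k + 1) = x k ∨ 4 * x (k + 1) = x k + a * b)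
    (hcop : Nat.Coprime (x 0) (a * b)) (hn : a ≤ 3 * 4 ^ n) :
    o4 (a * b) ≤ 2 ^ n * o4 b := by
  have hb : Odd b := (Nat.odd_mul.1 hab).2
  by_contra! hlt
  choose j hj hj' using fun k => hS.exists_dvd_add_moser n (hmem k)
  -- Both branches are division by 4 modulo any divisor of ab; this is used for b and for ab itself.
  have hmod (d : ℕ) (hd : d ∣ a * b) (k : ℕ) : (x k : ZMod d) * 4 ^ k = x 0 := by
    have hd0 : ((a * b : ℕ) : ZMod d) = 0 := (ZMod.natCast_eq_zero_iff _ _).2 hd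
    induction k with
    | zero => simp
    | succ k ih =>
      have : (4 : ZMod d) * x (k + 1) = x k := by
        rcases hstep k with h | h
        · exact_mod_cast congrArg (Nat.cast : ℕ → ZMod d) h
        · have := congrArg (Nat.cast : ℕ → ZMod d) h
          rw [Nat.cast_add, hd0, add_zero] at this
          exact_mod_cast this
      rw [← ih, ← this, pow_succ]; ring
  have h4 (d : ℕ) (hd : Odd d) : IsUnit (4 : ZMod d) := by
    have := (ZMod.unitOfCoprime 4 (coprime_four hd)).isUnit
    simpa using this
  have ho : 0 < o4 b := by
    have : NeZero b := ⟨by rintro rfl; simp at hb⟩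
    obtain ⟨u, hu⟩ := h4 b hb
    rw [o4, ← hu, orderOf_units]
    exact orderOf_pos u
  -- Pigeonhole: two indices below o_4(ab) share the record of n branches and the residue modulo
  -- o_4(b).
  obtain ⟨i, hi, i', hi', hne, heq⟩ :=
    Finset.exists_ne_map_eq_of_card_lt_of_maps_to
      (s := Finset.range (o4 (a * b))) (t := Finset.range (2 ^ n) ×ˢ Finset.range (o4 b))
      (f := fun k => (j k, k % o4 b)) (by simpa using hlt) (by
        intro k _
        simp only [Finset.coe_product, Set.mem_prod, Finset.coe_range, Set.mem_Iio]
        exact ⟨hj k, Nat.mod_lt _ ho⟩)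
  simp only [Prod.mk.injEq] at heq
  obtain ⟨hjj, hii⟩ := heq
  rw [Finset.mem_range] at hi hi'
  have hxb : x i ≡ x i' [MOD b] := by
    rw [← ZMod.natCast_eq_natCast_iff]
    have h1 := hmod b (dvd_mul_left _ _) i
    have h2 := hmod b (dvd_mul_left _ _) i'
    have hpow : (4 : ZMod b) ^ i = 4 ^ i' := by
      rw [← pow_mod_orderOf, ← pow_mod_orderOf _ i']
      exact congrArg _ hii
    rw [← h2, ← hpow] at h1
    exact ((h4 b hb).pow i).mul_right_cancel h1
  have hx4 : x i ≡ x i' [MOD 4 ^ n] := by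
    have h1 := (Nat.modEq_zero_iff_dvd.2 (hj' i))
    have h2 := (Nat.modEq_zero_iff_dvd.2 (hj' i'))
    rw [← hjj] at h2
    exact Nat.ModEq.add_right_cancel' _ (h1.trans h2.symm)
  have hx : x i ≡ x i' [MOD 4 ^ n * b] :=
    (Nat.modEq_and_modEq_iff_modEq_mul ((coprime_four hb).pow_left n)).1 ⟨hx4, hxb⟩
  -- The interval (0, 4^n b] contains each residue modulo 4^n b exactly once, so congruent orbit
  -- points are equal.
  have hbound (k : ℕ) : x k ≤ 4 ^ n * b ∧ 0 < x k := by
    refine ⟨?_, (hS _ (hmem k)).1⟩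
    have := hle k
    have := Nat.mul_le_mul_right b hn
    linarith [mul_assoc 3 (4 ^ n) b]
  have hxeq : x i = x i' := by
    have key (p q : ℕ) (hpq : x p ≡ x q [MOD 4 ^ n * b]) (hle' : x p ≤ x q) : x p = x q := by
      have h1 := (Nat.modEq_iff_dvd' hle').1 hpq
      have := Nat.eq_zero_of_dvd_of_lt h1 (by have := hbound p; have := hbound q; omega)
      omega
    rcases le_total (x i) (x i') with h | h
    · exact key _ _ hx h
    · exact (key _ _ hx.symm h).symm
  have h1 := hmod _ dvd_rfl i
  have h2 := hmod _ dvd_rfl i'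
  rw [← h2, hxeq] at h1
  have hu : IsUnit (x i' : ZMod (a * b)) := by
    refine isUnit_of_mul_isUnit_left (y := 4 ^ i') ?_
    rw [h2]
    exact (ZMod.unitOfCoprime _ hcop).isUnit
  have h3 := hu.mul_left_cancel h1
  obtain ⟨u, hu4⟩ := h4 _ hab
  rw [o4, ← hu4, orderOf_units] at hi hi'
  rw [← hu4] at h3
  exact hne (pow_injOn_Iio_orderOf hi hi' (Units.ext (by simpa using h3)))

/-- Since a ≥ 1, √(a/3) > 1/2, so the logarithm exceeds -1 and its ceiling is a natural number. -/
lemma exists_nat_ceil_logb {a : ℕ} (ha : 0 < a) :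
    ∃ n : ℕ, (2 : ℝ) ^ ⌈Real.logb 2 (Real.sqrt ((a : ℝ) / 3))⌉ = 2 ^ n ∧ a ≤ 3 * 4 ^ n := by
  have ha' : (1 : ℝ) ≤ a := by exact_mod_cast ha
  have hs : 0 < Real.sqrt ((a : ℝ) / 3) := Real.sqrt_pos.2 (by positivity)
  have h0 : (0 : ℤ) ≤ ⌈Real.logb 2 (Real.sqrt ((a : ℝ) / 3))⌉ := by
    have : (-1 : ℤ) < ⌈Real.logb 2 (Real.sqrt ((a : ℝ) / 3))⌉ := by
      rw [Int.lt_ceil, Real.lt_logb_iff_rpow_lt (by norm_num) hs]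
      rw [Real.lt_sqrt (by positivity)]
      push_cast
      rw [Real.rpow_neg_one]
      linarith
    omega
  obtain ⟨n, hn⟩ := Int.eq_ofNat_of_zero_le h0
  refine ⟨n, by rw [hn]; simp, ?_⟩
  have h1 : Real.logb 2 (Real.sqrt ((a : ℝ) / 3)) ≤ n := by
    have := Int.le_ceil (Real.logb 2 (Real.sqrt ((a : ℝ) / 3)))
    rw [hn] at this
    exact_mod_cast this
  rw [Real.logb_le_iff_le_rpow (by norm_num) hs, Real.rpow_natCast,
    Real.sqrt_le_left (by positivity)] at h1
  have h2 : (a : ℝ) ≤ 3 * 4 ^ n := by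
    have : ((2 : ℝ) ^ n) ^ 2 = 4 ^ n := by rw [← pow_mul, mul_comm, pow_mul]; norm_num
    linarith
  exact_mod_cast h2

/-! ### Exponentials in `L²` of a finite measure on the line -/

/-- Uniqueness of the Fourier transform for real integrable densities. -/
lemma ae_eq_zero_of_fourier_eq_zero {μ : Measure ℝ} {g : ℝ → ℝ} (hg : Integrable g μ)
    (h : ∀ s : ℝ, ∫ x, (g x : ℂ) * Complex.exp (s * x * Complex.I) ∂μ = 0) : g =ᵐ[μ] 0 := by
  have hfin1 := isFiniteMeasure_withDensity_ofReal hg.2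
  have hfin2 := isFiniteMeasure_withDensity_ofReal hg.neg.2
  have hm1 : AEMeasurable (fun x => ENNReal.ofReal (g x)) μ := hg.1.aemeasurable.ennreal_ofReal
  have hm2 : AEMeasurable (fun x => ENNReal.ofReal ((-g) x)) μ :=
    hg.neg.1.aemeasurable.ennreal_ofReal
  have hbd {u : ℝ → ℝ} (hu : Integrable u μ) (s : ℝ) :
      Integrable (fun x => (u x : ℂ) * Complex.exp (s * x * Complex.I)) μ := by
    refine hu.ofReal.mul_bdd (c := 1) (by fun_prop) (Filter.Eventually.of_forall fun x => ?_)
    rw [Complex.norm_exp]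
    simp
  have hchar {u : ℝ → ℝ} (hm : AEMeasurable (fun x => ENNReal.ofReal (u x)) μ) (s : ℝ) :
      charFun (μ.withDensity fun x => ENNReal.ofReal (u x)) s =
        ∫ x, ((max (u x) 0 : ℝ) : ℂ) * Complex.exp (s * x * Complex.I) ∂μ := by
    rw [charFun_apply_real, integral_withDensity_eq_integral_toReal_smul₀ hm (by simp)]
    simp only [ENNReal.toReal_ofReal', Complex.real_smul]
  -- The positive and negative parts of g are densities of finite measures with equal characteristic
  -- functions.
  have heq : (μ.withDensity fun x => ENNReal.ofReal (g x)) =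
      μ.withDensity fun x => ENNReal.ofReal ((-g) x) := by
    refine Measure.ext_of_charFun (funext fun s => ?_)
    rw [hchar hm1, hchar hm2, ← sub_eq_zero,
      ← integral_sub (hbd hg.pos_part s) (hbd hg.neg.pos_part s), ← h s]
    refine integral_congr_ae (Filter.Eventually.of_forall fun x => ?_)
    simp only [← sub_mul, ← Complex.ofReal_sub]
    congr 2
    rw [Pi.neg_apply]
    rcases le_total (g x) 0 with h0 | h0
    · rw [max_eq_right h0, max_eq_left (by linarith)]; ring
    · rw [max_eq_left h0, max_eq_right (by linarith)]; ring
  rw [withDensity_eq_iff hm1 hm2 (by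
    have := hfin1.measure_univ_lt_top.ne
    rwa [withDensity_apply _ MeasurableSet.univ, Measure.restrict_univ] at this)] at heq
  filter_upwards [heq] with x hx
  simp only [Pi.neg_apply] at hx
  rcases le_total (g x) 0 with h0 | h0
  · rw [ENNReal.ofReal_of_nonpos h0, eq_comm, ENNReal.ofReal_eq_zero] at hx
    simp only [Pi.zero_apply]; linarith
  · rw [ENNReal.ofReal_of_nonpos (by linarith : -g x ≤ 0), ENNReal.ofReal_eq_zero] at hx
    simp only [Pi.zero_apply]; linarith

section Exponentials

variable {μ : Measure ℝ} [IsFiniteMeasure μ]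

lemma memLp_exponential (μ : Measure ℝ) [IsFiniteMeasure μ] (t : ℝ) :
    MemLp (fun x : ℝ => Complex.exp (2 * Real.pi * Complex.I * (t * x : ℝ))) 2 μ := by
  refine MemLp.of_bound (by fun_prop) 1 (Filter.Eventually.of_forall fun x => le_of_eq ?_)
  rw [Complex.norm_exp]
  simp

/-- The function `x ↦ exp (2 π i t x)` as an element of `L²(μ)`. -/
noncomputable def exponential (μ : Measure ℝ) [IsFiniteMeasure μ] (t : ℝ) : Lp ℂ 2 μ :=
  (memLp_exponential μ t).toLp

lemma coeFn_exponential (t : ℝ) : (exponential μ t : ℝ → ℂ) =ᵐ[μ]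
    fun x => Complex.exp (2 * Real.pi * Complex.I * (t * x : ℝ)) :=
  (memLp_exponential μ t).coeFn_toLp

lemma inner_exponential_left (t : ℝ) (f : Lp ℂ 2 μ) :
    inner ℂ (exponential μ t) f =
      ∫ x, f x * Complex.exp ((-(2 * Real.pi * t) : ℝ) * x * Complex.I) ∂μ := by
  rw [L2.inner_def]
  refine integral_congr_ae ?_
  filter_upwards [coeFn_exponential (μ := μ) t] with x hx
  rw [hx, RCLike.inner_apply, ← Complex.exp_conj]
  congr 2
  simp only [map_mul, Complex.conj_I, Complex.conj_ofReal, map_ofNat]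
  push_cast; ring

lemma inner_exponential (s t : ℝ) :
    inner ℂ (exponential μ s) (exponential μ t) = charFun μ (2 * Real.pi * (t - s)) := by
  rw [inner_exponential_left, charFun_apply_real]
  refine integral_congr_ae ?_
  filter_upwards [coeFn_exponential (μ := μ) t] with x hx
  rw [hx, ← Complex.exp_add]
  congr 1
  push_cast; ring

/-- The exponentials are total in `L²(μ)`. -/
lemma eq_zero_of_inner_exponential_eq_zero {f : Lp ℂ 2 μ}
    (h : ∀ t, inner ℂ (exponential μ t) f = 0) : f = 0 := by
  have hf : Integrable f μ := (Lp.memLp f).integrable (by norm_num)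
  have h1 (s : ℝ) : ∫ x, f x * Complex.exp (s * x * Complex.I) ∂μ = 0 := by
    have := h (-(s / (2 * Real.pi)))
    rw [inner_exponential_left] at this
    rw [← this]
    have hs : -(2 * Real.pi * -(s / (2 * Real.pi))) = s := by
      have := Real.pi_pos.ne'
      field_simp
    rw [hs]
  -- Conjugation replaces s by -s, so the conjugate of f also has vanishing transform; hence so do
  -- the real and imaginary parts.
  have h2 (s : ℝ) : ∫ x, (starRingEnd ℂ) (f x) * Complex.exp (s * x * Complex.I) ∂μ = 0 := by
    have := congrArg (starRingEnd ℂ) (h1 (-s))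
    rw [← integral_conj, map_zero] at this
    rw [← this]
    refine integral_congr_ae (Filter.Eventually.of_forall fun x => ?_)
    simp only [map_mul, ← Complex.exp_conj, Complex.conj_I, Complex.conj_ofReal]
    congr 2
    push_cast; ring
  have hexp (s : ℝ) : ∀ᵐ x : ℝ ∂μ, ‖Complex.exp (s * x * Complex.I)‖ ≤ 1 :=
    Filter.Eventually.of_forall fun x => by rw [Complex.norm_exp]; simp
  have hi1 (s : ℝ) : Integrable (fun x => f x * Complex.exp (s * x * Complex.I)) μ :=
    hf.mul_bdd (c := 1) (by fun_prop) (hexp s)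
  have hi2 (s : ℝ) :
      Integrable (fun x => (starRingEnd ℂ) (f x) * Complex.exp (s * x * Complex.I)) μ :=
    (Complex.conjCLE.integrable_comp_iff.2 hf).mul_bdd (c := 1) (by fun_prop) (hexp s)
  have hre := ae_eq_zero_of_fourier_eq_zero hf.re fun s => by
    have : ∀ x, ((RCLike.re (f x) : ℝ) : ℂ) * Complex.exp (s * x * Complex.I) =
        2⁻¹ * (f x * Complex.exp (s * x * Complex.I) +
          (starRingEnd ℂ) (f x) * Complex.exp (s * x * Complex.I)) := fun x => by
      rw [← add_mul, Complex.add_conj, ← mul_assoc]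
      simp
    simp only [this]
    rw [integral_const_mul, integral_add (hi1 s) (hi2 s), h1, h2]
    simp
  have him := ae_eq_zero_of_fourier_eq_zero hf.im fun s => by
    have : ∀ x, ((RCLike.im (f x) : ℝ) : ℂ) * Complex.exp (s * x * Complex.I) =
        (2 * Complex.I)⁻¹ * (f x * Complex.exp (s * x * Complex.I) -
          (starRingEnd ℂ) (f x) * Complex.exp (s * x * Complex.I)) := fun x => by
      rw [← sub_mul, Complex.sub_conj, ← mul_assoc]
      congr 1
      push_cast
      field_simp
      simp
    simp only [this]
    rw [integral_const_mul, integral_sub (hi1 s) (hi2 s), h1, h2]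
    simp
  rw [Lp.eq_zero_iff_ae_eq_zero]
  filter_upwards [hre, him] with x h3 h4
  exact Complex.ext h3 h4

end Exponentials

/-! ### The Fourier transform of the Cantor measure -/

/-- The Fourier transform `t ↦ ∫ exp (2 π i t x) dμ(x)` of the Cantor measure. -/
noncomputable def cantorFourier (t : ℝ) : ℂ := charFun cantorMeasure (2 * Real.pi * t)

lemma cantorFourier_zero : cantorFourier 0 = 1 := by
  simp [cantorFourier]

lemma norm_cantorFourier_neg (t : ℝ) : ‖cantorFourier (-t)‖ = ‖cantorFourier t‖ := by
  rw [cantorFourier, mul_neg, charFun_neg, RCLike.norm_conj, cantorFourier]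

lemma continuous_cantorFourier : Continuous cantorFourier :=
  continuous_charFun.comp (by fun_prop)

lemma cantorMeasure_eq : cantorMeasure = (2⁻¹ : ℝ≥0∞) •
    (cantorMeasure.map (fun x => x / 4) + cantorMeasure.map fun x => (x + 2) / 4) := by
  ext E hE
  rw [cantorMeasure_invariant E hE, Measure.smul_apply, Measure.add_apply,
    Measure.map_apply (by fun_prop) hE, Measure.map_apply (by fun_prop) hE, smul_eq_mul]

lemma cantorFourier_eq (t : ℝ) :
    cantorFourier t = (1 + Complex.exp (Real.pi * t * Complex.I)) / 2 * cantorFourier (t / 4) := by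
  have hint (u : ℝ → ℝ) (hu : Measurable u) :
      Integrable (fun x : ℝ => Complex.exp ((2 * Real.pi * t : ℝ) * x * Complex.I))
        (cantorMeasure.map u) := by
    have := Measure.isProbabilityMeasure_map (μ := cantorMeasure) hu.aemeasurable
    refine Integrable.of_bound (by fun_prop) 1 (Filter.Eventually.of_forall fun x => ?_)
    rw [Complex.norm_exp]
    simp
  have h0 : Measurable fun x : ℝ => x / 4 := by fun_prop
  have h2 : Measurable fun x : ℝ => (x + 2) / 4 := by fun_prop
  rw [cantorFourier, cantorFourier, charFun_apply_real, charFun_apply_real]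
  conv_lhs => rw [cantorMeasure_eq]
  rw [integral_smul_measure, integral_add_measure (hint _ h0) (hint _ h2),
    integral_map h0.aemeasurable (by fun_prop), integral_map h2.aemeasurable (by fun_prop)]
  have e0 (x : ℝ) : Complex.exp ((2 * Real.pi * t : ℝ) * (x / 4 : ℝ) * Complex.I) =
      Complex.exp ((2 * Real.pi * (t / 4) : ℝ) * x * Complex.I) := by
    congr 1; push_cast; ring
  have e2 (x : ℝ) : Complex.exp ((2 * Real.pi * t : ℝ) * ((x + 2) / 4 : ℝ) * Complex.I) =
      Complex.exp (Real.pi * t * Complex.I) *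
        Complex.exp ((2 * Real.pi * (t / 4) : ℝ) * x * Complex.I) := by
    rw [← Complex.exp_add]
    congr 1; push_cast; ring
  simp only [e2]
  simp only [e0, integral_const_mul, ENNReal.toReal_inv, ENNReal.toReal_ofNat,
    Complex.real_smul]
  push_cast; ring

lemma norm_sq_cantorFourier (t : ℝ) :
    ‖cantorFourier t‖ ^ 2 = Real.cos (Real.pi * t / 2) ^ 2 * ‖cantorFourier (t / 4)‖ ^ 2 := by
  have h : (1 + Complex.exp (Real.pi * t * Complex.I)) / 2 =
      (Real.cos (Real.pi * t / 2) : ℝ) * Complex.exp ((Real.pi * t / 2 : ℝ) * Complex.I) := by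
    have e : Complex.exp (Real.pi * t * Complex.I) =
        Complex.exp ((Real.pi * t / 2 : ℝ) * Complex.I) ^ 2 := by
      rw [← Complex.exp_nat_mul]; congr 1; push_cast; ring
    rw [e, Complex.ofReal_cos, Complex.cos, neg_mul, Complex.exp_neg]
    have := Complex.exp_ne_zero ((Real.pi * t / 2 : ℝ) * Complex.I)
    field_simp
    ring
  rw [cantorFourier_eq, h, norm_mul, norm_mul, Complex.norm_exp_ofReal_mul_I, mul_one,
    Complex.norm_real, mul_pow, Real.norm_eq_abs, sq_abs]

/-- At odd integers the factor 1 + exp(πit) vanishes, and `cantorFourier_eq` carries a zero at t/4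
to t. -/
lemma cantorFourier_eq_zero (k : ℕ) {j : ℤ} (hj : Odd j) :
    cantorFourier ((4 ^ k * j : ℤ) : ℝ) = 0 := by
  induction k with
  | zero =>
    obtain ⟨r, rfl⟩ := hj
    have e : Complex.exp (Real.pi * ((4 ^ 0 * (2 * r + 1) : ℤ) : ℝ) * Complex.I) = -1 := by
      rw [← Complex.exp_pi_mul_I, Complex.exp_eq_exp_iff_exists_int]
      exact ⟨r, by push_cast; ring⟩
    rw [cantorFourier_eq, e]
    simp
  | succ k ih =>
    rw [cantorFourier_eq]
    have : ((4 ^ (k + 1) * j : ℤ) : ℝ) / 4 = ((4 ^ k * j : ℤ) : ℝ) := by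
      push_cast; rw [pow_succ]; ring
    rw [this, ih, mul_zero]

/-! ### Extreme cycles and completeness -/

local notation "𝐞" => exponential cantorMeasure

lemma inner_exponential_cantorMeasure (s t : ℝ) :
    inner ℂ (𝐞 s) (𝐞 t) = cantorFourier (t - s) := inner_exponential s t

lemma norm_exponential_cantorMeasure (t : ℝ) : ‖𝐞 t‖ = 1 := by
  rw [norm_eq_sqrt_re_inner (𝕜 := ℂ), inner_exponential_cantorMeasure, sub_self,
    cantorFourier_zero]
  simp

lemma orthonormal_exponential {m : ℕ} (hm : Odd m) :
    Orthonormal ℂ fun n : ℕ => 𝐞 (m * moser n) := by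
  refine ⟨fun n => norm_exponential_cantorMeasure _, fun n n' hne => ?_⟩
  obtain ⟨k, j, hj, e⟩ := moser_diff hne.symm
  rw [inner_exponential_cantorMeasure]
  have : (m : ℝ) * moser n' - m * moser n = ((4 ^ k * (m * j) : ℤ) : ℝ) := by
    have := congrArg (Int.cast : ℤ → ℝ) e
    push_cast at this ⊢
    linear_combination (m : ℝ) * this
  rw [this]
  exact cantorFourier_eq_zero k (Odd.mul (by exact_mod_cast hm) hj)

/-- For odd m orthonormality is automatic, so only totality has to be checked. -/
lemma isComplete_of_forall {m : ℕ} (hm : Odd m)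
    (h : ∀ f : Lp ℂ 2 cantorMeasure, (∀ n : ℕ, inner ℂ (𝐞 (m * moser n)) f = 0) → f = 0) :
    IsComplete m := by
  have hmem (l : Gam m) : ∃ n : ℕ, (m : ℝ) * moser n = l := by
    have : (l : ℝ) ∈ Set.range fun n : ℕ => (m : ℝ) * moser n := Gam_eq_range m ▸ l.2
    exact this
  choose c hc using hmem
  have hcinj : Function.Injective c := fun l l' e => Subtype.ext (by rw [← hc, ← hc, e])
  have hon : Orthonormal ℂ fun l : Gam m => 𝐞 (l : ℝ) := by
    have := (orthonormal_exponential hm).comp c hcinj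
    simpa only [Function.comp_def, hc] using this
  refine ⟨HilbertBasis.mkOfOrthogonalEqBot hon ?_, fun l => ?_⟩
  · rw [Submodule.eq_bot_iff]
    intro f hf
    refine h f fun n => ?_
    rw [Submodule.mem_orthogonal] at hf
    exact hf _ (Submodule.subset_span ⟨⟨m * moser n, by rw [Gam_eq_range]; exact ⟨n, rfl⟩⟩, rfl⟩)
  · rw [HilbertBasis.coe_mkOfOrthogonalEqBot]
    exact coeFn_exponential _

/-- A nontrivial extreme cycle is an obstruction to completeness. -/
lemma SuccClosed.not_isComplete {m : ℕ} (hm : Odd m) {S : Set ℕ} (hS : SuccClosed m S)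
    (hne : S.Nonempty) : ¬ IsComplete m := by
  rintro ⟨e, he⟩
  obtain ⟨x, hx⟩ := hne
  -- All coefficients of the unit vector `𝐞 (-x)` in the supposed basis vanish.
  have hrep : ∀ l : Gam m, inner ℂ (e l) (𝐞 (-x)) = 0 := by
    rintro ⟨l, hl⟩
    have hel : e ⟨l, hl⟩ = 𝐞 l := Lp.ext ((he _).trans (coeFn_exponential l).symm)
    rw [hel, inner_exponential_cantorMeasure]
    rw [Gam_eq_range] at hl
    obtain ⟨n, rfl⟩ := hl
    obtain ⟨k, j, hj, hkj⟩ := hS.add_moser hm hx n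
    have : -(x : ℝ) - m * moser n = ((4 ^ k * (-j) : ℤ) : ℝ) := by
      have := congrArg (Int.cast : ℤ → ℝ) hkj
      push_cast at this ⊢
      linear_combination -this
    rw [this]
    exact cantorFourier_eq_zero k hj.neg
  have h0 : 𝐞 (-x) = 0 := by
    rw [← e.repr.map_eq_zero_iff]
    ext l
    rw [e.repr_apply_apply, hrep]
    rfl
  have := norm_exponential_cantorMeasure (-x)
  rw [h0, norm_zero] at this
  exact zero_ne_one this

/-! ### The spectral sum and its minimisers -/

/-- The sum `∑ |μ̂(t + λ)|²` over `λ ∈ Γ(m)`. -/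
noncomputable def spectralSum (m : ℕ) (t : ℝ) : ℝ≥0∞ :=
  ∑' n : ℕ, ENNReal.ofReal (‖cantorFourier (t + m * moser n)‖ ^ 2)

lemma lowerSemicontinuous_spectralSum (m : ℕ) : LowerSemicontinuous (spectralSum m) := by
  refine lowerSemicontinuous_tsum fun n => Continuous.lowerSemicontinuous ?_
  exact ENNReal.continuous_ofReal.comp
    ((continuous_cantorFourier.comp (by fun_prop)).norm.pow 2)

lemma one_le_spectralSum_zero (m : ℕ) : 1 ≤ spectralSum m 0 := by
  refine le_trans (le_of_eq ?_) (ENNReal.le_tsum 0)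
  simp [cantorFourier_zero]

/-- Split Γ(m) by its lowest digit. As m is odd, adding it to t shifts the cosine's argument by an
odd multiple of π/2, giving a squared sine. -/
lemma spectralSum_eq {m : ℕ} (hm : Odd m) (t : ℝ) :
    spectralSum m t = ENNReal.ofReal (Real.cos (Real.pi * t / 2) ^ 2) * spectralSum m (t / 4) +
      ENNReal.ofReal (Real.sin (Real.pi * t / 2) ^ 2) * spectralSum m ((t + m) / 4) := by
  obtain ⟨r, hr⟩ := hm
  rw [spectralSum, ← tsum_even_add_odd ENNReal.summable ENNReal.summable, spectralSum,
    spectralSum, ← ENNReal.tsum_mul_left, ← ENNReal.tsum_mul_left]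
  congr 1
  · refine tsum_congr fun n => ?_
    rw [← ENNReal.ofReal_mul (sq_nonneg _), norm_sq_cantorFourier, moser_two_mul]
    have h1 : Real.pi * (t + m * (4 * moser n : ℕ)) / 2 =
        Real.pi * t / 2 + (m * moser n : ℕ) * (2 * Real.pi) := by push_cast; ring
    have h2 : (t + m * (4 * moser n : ℕ)) / 4 = t / 4 + m * moser n := by push_cast; ring
    rw [h1, h2, Real.cos_add_nat_mul_two_pi]
  · refine tsum_congr fun n => ?_
    rw [← ENNReal.ofReal_mul (sq_nonneg _), norm_sq_cantorFourier, moser_two_mul_add_one]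
    have h1 : Real.pi * (t + m * (4 * moser n + 1 : ℕ)) / 2 =
        Real.pi * t / 2 + Real.pi / 2 + (2 * (m * moser n) + r : ℕ) * Real.pi := by
      push_cast [hr]; ring
    have h2 : (t + m * (4 * moser n + 1 : ℕ)) / 4 = (t + m) / 4 + m * moser n := by
      push_cast; ring
    rw [h1, h2, Real.cos_add_nat_mul_pi, Real.cos_add_pi_div_two, mul_pow, ← pow_mul, mul_comm _ 2,
      pow_mul, neg_one_sq, one_pow, one_mul, neg_sq]

/-- Bessel's inequality for an exponential, sharpened by a vector orthogonal to `Γ(m)`. -/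
lemma inner_eq_zero_of_one_le_spectralSum {m : ℕ} (hm : Odd m) {f : Lp ℂ 2 cantorMeasure}
    (hf : ∀ n : ℕ, inner ℂ (𝐞 (m * moser n)) f = 0) {t : ℝ} (ht : 1 ≤ spectralSum m t) :
    inner ℂ (𝐞 (-t)) f = 0 := by
  have hv := orthonormal_exponential hm
  set K := Submodule.span ℂ {f}
  set u := K.starProjection (𝐞 (-t))
  obtain ⟨c, hc⟩ := Submodule.mem_span_singleton.1 (K.starProjection_apply_mem (𝐞 (-t)))
  have hperp : inner ℂ (𝐞 (-t) - u) f = 0 :=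
    K.starProjection_inner_eq_zero _ _ (Submodule.mem_span_singleton_self f)
  -- Since f is orthogonal to Γ(m), subtracting the projection u onto the line of f changes no
  -- coefficient. Bessel bounds the sum by 1 - ‖u‖², which forces u = 0.
  have hsum : spectralSum m t ≤ ENNReal.ofReal (‖𝐞 (-t) - u‖ ^ 2) := by
    rw [spectralSum, ENNReal.tsum_eq_iSup_sum]
    refine iSup_le fun s => ?_
    rw [← ENNReal.ofReal_sum_of_nonneg fun n _ => sq_nonneg _]
    refine ENNReal.ofReal_le_ofReal ?_
    refine le_trans (le_of_eq ?_) (hv.sum_inner_products_le (x := 𝐞 (-t) - u) (s := s))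
    refine Finset.sum_congr rfl fun n _ => ?_
    rw [inner_sub_right, show u = c • f from hc.symm, inner_smul_right, hf, mul_zero, sub_zero,
      inner_exponential_cantorMeasure, ← norm_cantorFourier_neg, neg_add']
  have h1 : 1 ≤ ‖𝐞 (-t) - u‖ ^ 2 := by
    have := ht.trans hsum
    rwa [← ENNReal.ofReal_one, ENNReal.ofReal_le_ofReal_iff (sq_nonneg _)] at this
  have hpyth : ‖𝐞 (-t)‖ * ‖𝐞 (-t)‖ = ‖𝐞 (-t) - u‖ * ‖𝐞 (-t) - u‖ + ‖u‖ * ‖u‖ := by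
    have : inner ℂ (𝐞 (-t) - u) u = 0 := by
      rw [show u = c • f from hc.symm, inner_smul_right] at *
      rw [hperp, mul_zero]
    rw [← norm_add_sq_eq_norm_sq_add_norm_sq_of_inner_eq_zero _ _ this, sub_add_cancel]
  rw [norm_exponential_cantorMeasure] at hpyth
  have hu : u = 0 := by
    rw [← norm_eq_zero]
    nlinarith [norm_nonneg u]
  rwa [hu, sub_zero] at hperp

lemma eq_left_of_convex_combination_eq {w w' q q' c : ℝ≥0∞} (hw : w + w' = 1) (hc : c ≠ ∞)
    (h : c = w * q + w' * q') (hq : c ≤ q) (hq' : c ≤ q') (h0 : w ≠ 0) : q = c := by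
  have hw1 : w ≠ ∞ := fun e => by simp [e] at hw
  have hw2 : w' ≠ ∞ := fun e => by simp [e] at hw
  refine le_antisymm (not_lt.1 fun hlt => ?_) hq
  have h1 : w * c < w * q := by
    rw [mul_comm w, mul_comm w]
    exact ENNReal.mul_lt_mul_left h0 hw1 hlt
  have h2 : w * c + w' * c < w * q + w' * q' :=
    ENNReal.add_lt_add_of_lt_of_le (ENNReal.mul_ne_top hw2 hc) h1 (by gcongr)
  rw [← add_mul, hw, one_mul, ← h] at h2
  exact lt_irrefl _ h2

/-- An incomplete odd number admits a nontrivial extreme cycle: the minimisers of the spectral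
sum on a large interval are nonzero integers. -/
lemma exists_succClosed {m : ℕ} (hm : Odd m) (h : ¬ IsComplete m) :
    ∃ S : Set ℕ, S.Nonempty ∧ SuccClosed m S := by
  obtain ⟨t₀, ht₀⟩ : ∃ t, spectralSum m t < 1 := by
    by_contra! H
    refine h (isComplete_of_forall hm fun f hf =>
      eq_zero_of_inner_exponential_eq_zero fun t => ?_)
    have := inner_eq_zero_of_one_le_spectralSum hm hf (H (-t))
    rwa [neg_neg] at this
  have hm0 : (0 : ℝ) ≤ m := by positivity
  -- An interval containing t₀ and mapped into itself by both branches.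
  set J := Set.Icc (-|t₀|) (|t₀| + m) with hJ
  have htJ : t₀ ∈ J := ⟨neg_abs_le _, by linarith [le_abs_self t₀]⟩
  have hlsc := lowerSemicontinuous_spectralSum m
  obtain ⟨t₁, ht₁, hmin⟩ :=
    (hlsc.lowerSemicontinuousOn J).exists_isMinOn ⟨t₀, htJ⟩ isCompact_Icc
  set c := spectralSum m t₁ with hcdef
  have hmin' : ∀ t ∈ J, c ≤ spectralSum m t := hmin
  have hc : c < 1 := (hmin' t₀ htJ).trans_lt ht₀
  have hJ1 {t : ℝ} (ht : t ∈ J) : t / 4 ∈ J := by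
    have := abs_nonneg t₀
    exact ⟨by linarith [ht.1], by linarith [ht.2]⟩
  have hJ2 {t : ℝ} (ht : t ∈ J) : (t + m) / 4 ∈ J := by
    have := abs_nonneg t₀
    exact ⟨by linarith [ht.1], by linarith [ht.2]⟩
  have hw (t : ℝ) : ENNReal.ofReal (Real.cos (Real.pi * t / 2) ^ 2) +
      ENNReal.ofReal (Real.sin (Real.pi * t / 2) ^ 2) = 1 := by
    rw [← ENNReal.ofReal_add (sq_nonneg _) (sq_nonneg _), Real.cos_sq_add_sin_sq,
      ENNReal.ofReal_one]
  -- By `spectralSum_eq` a minimum is a convex combination of values at least c, so each branch of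
  -- nonzero weight leads to another minimiser.
  set E := {t | t ∈ J ∧ spectralSum m t = c} with hE
  have hE1 {t : ℝ} (ht : t ∈ E) (hcos : Real.cos (Real.pi * t / 2) ≠ 0) : t / 4 ∈ E := by
    refine ⟨hJ1 ht.1, eq_left_of_convex_combination_eq (hw t) hc.ne_top
      (ht.2.symm.trans (spectralSum_eq hm t)) (hmin' _ (hJ1 ht.1)) (hmin' _ (hJ2 ht.1)) ?_⟩
    rw [Ne, ENNReal.ofReal_eq_zero, not_le]
    positivity
  have hE2 {t : ℝ} (ht : t ∈ E) (hsin : Real.sin (Real.pi * t / 2) ≠ 0) : (t + m) / 4 ∈ E := by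
    refine ⟨hJ2 ht.1, eq_left_of_convex_combination_eq ((add_comm _ _).trans (hw t)) hc.ne_top
      (ht.2.symm.trans ((spectralSum_eq hm t).trans (add_comm _ _))) (hmin' _ (hJ2 ht.1))
      (hmin' _ (hJ1 ht.1)) ?_⟩
    rw [Ne, ENNReal.ofReal_eq_zero, not_le]
    positivity
  have hcos {t : ℝ} (ht : Real.cos (Real.pi * t / 2) = 0) : ∃ k : ℤ, t = 2 * k + 1 := by
    obtain ⟨k, hk⟩ := Real.cos_eq_zero_iff.1 ht
    refine ⟨k, ?_⟩
    have := Real.pi_pos.ne'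
    field_simp at hk
    exact hk
  -- For non-integral t no t/4^k is an odd integer, so every t/4^k is a minimiser. They tend to 0,
  -- where the sum is at least 1 > c, against lower semicontinuity.
  have hint {t : ℝ} (ht : t ∈ E) : ∃ z : ℤ, t = z := by
    by_contra! hz
    have hmem (k : ℕ) : t / 4 ^ k ∈ E := by
      induction k with
      | zero => simpa using ht
      | succ k ih =>
        rw [pow_succ, ← div_div]
        refine hE1 ih fun h0 => ?_
        obtain ⟨j, hj⟩ := hcos h0
        rw [div_eq_iff (by positivity)] at hj
        exact hz ((2 * j + 1) * 4 ^ k) (by rw [hj]; push_cast; ring)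
    have hlim : Filter.Tendsto (fun k : ℕ => t / 4 ^ k) Filter.atTop (nhds 0) := by
      have := (tendsto_pow_atTop_nhds_zero_of_lt_one (r := (4 : ℝ)⁻¹) (by norm_num)
        (by norm_num)).const_mul t
      rw [mul_zero] at this
      refine this.congr fun k => ?_
      rw [inv_pow, div_eq_mul_inv]
    obtain ⟨k, hk⟩ := (hlim.eventually
      (hlsc 0 c (hc.trans_le (one_le_spectralSum_zero m)))).exists
    exact hk.ne' (hmem k).2
  have hsucc (z : ℤ) (hz : (z : ℝ) ∈ E) :
      ∃ y : ℤ, (y : ℝ) ∈ E ∧ (4 * y = z ∨ 4 * y = z + m ∧ Odd z) := by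
    by_cases h0 : Real.cos (Real.pi * z / 2) = 0
    · have hs : Real.sin (Real.pi * z / 2) ≠ 0 := fun hs => by
        have := Real.cos_sq_add_sin_sq (Real.pi * z / 2)
        simp [h0, hs] at this
      have hmem := hE2 hz hs
      obtain ⟨y, hy⟩ := hint hmem
      obtain ⟨k, hk⟩ := hcos h0
      refine ⟨y, hy ▸ hmem, Or.inr ⟨?_, k, by exact_mod_cast hk⟩⟩
      have : (4 : ℝ) * y = z + m := by rw [← hy]; ring
      exact_mod_cast this
    · have hmem := hE1 hz h0
      obtain ⟨y, hy⟩ := hint hmem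
      refine ⟨y, hy ▸ hmem, Or.inl ?_⟩
      have : (4 : ℝ) * y = z := by rw [← hy]; ring
      exact_mod_cast this
  have hne0 : (0 : ℝ) ∉ E := fun h0 => by
    have := one_le_spectralSum_zero m
    rw [h0.2] at this
    exact absurd hc (not_lt.2 this)
  obtain ⟨z₁, hz₁⟩ := hint (show t₁ ∈ E from ⟨ht₁, rfl⟩)
  obtain ⟨M, hM, hMmax⟩ := Int.exists_greatest_of_bdd (P := fun z : ℤ => (z : ℝ) ∈ E)
    ⟨⌈|t₀| + m⌉, fun z hz => by
      have : (z : ℝ) ≤ ⌈|t₀| + m⌉ := hz.1.2.trans (Int.le_ceil _)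
      exact_mod_cast this⟩ ⟨z₁, hz₁ ▸ ⟨ht₁, rfl⟩⟩
  -- A successor y ≤ M of the greatest integer minimiser gives 3M ≤ 0 when 4y = M is excluded for
  -- negative M, and otherwise 4y = M + m gives 3M ≥ m > 0.
  have hMpos : 0 < M := by
    have hM0 : M ≠ 0 := by rintro rfl; exact hne0 (by simpa using hM)
    have hmpos := hm.pos
    obtain ⟨y, hy, hyM⟩ := hsucc M hM
    have := hMmax y hy
    omega
  refine ⟨{n | 0 < n ∧ (n : ℝ) ∈ E}, ⟨M.toNat, by omega, ?_⟩, fun n hn => ⟨hn.1, ?_⟩⟩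
  · have : ((M.toNat : ℤ) : ℝ) = M := by rw [Int.toNat_of_nonneg hMpos.le]
    rw [Int.cast_natCast] at this
    rwa [this]
  · obtain ⟨hn0, hnE⟩ := hn
    obtain ⟨y, hy, hyn⟩ := hsucc n (by simpa using hnE)
    have hy0 : 0 < y := by omega
    lift y to ℕ using hy0.le
    refine ⟨y, ⟨by omega, by simpa using hy⟩, by omega⟩

/-! ### Primitive numbers -/

lemma not_isPrimitive_mul {a b n : ℕ} (hn : a ≤ 3 * 4 ^ n) (h : 2 ^ n * o4 b < o4 (a * b)) :
    ¬ IsPrimitive (a * b) := by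
  rintro ⟨hodd, hinc, hdiv⟩
  obtain ⟨S, hne, hS⟩ := exists_succClosed hodd hinc
  obtain ⟨x, hmem, hle, hstep⟩ := hS.exists_seq hne
  refine absurd h (not_lt.2 (o4_mul_le hodd hS hmem hle hstep ?_ hn))
  set g := Nat.gcd (x 0) (a * b)
  have hg : g ∣ a * b := Nat.gcd_dvd_right _ _
  have hcyc := SuccClosed.div_gcd hodd (fun k => (hS _ (hmem k)).1) hstep
  have hquot : a * b / g ∣ a * b := Nat.div_dvd_of_dvd hg
  have hnc := hcyc.not_isComplete (hodd.of_dvd_nat hquot) (Set.range_nonempty _)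
  by_contra hg1
  -- A common factor g > 1 would make the proper divisor ab/g incomplete.
  have hg2 : 1 < g := by
    have : g ≠ 1 := hg1
    have : 0 < g := Nat.gcd_pos_of_pos_right _ hodd.pos
    omega
  exact hnc (hdiv _ (Nat.mem_properDivisors.2 ⟨hquot, Nat.div_lt_self hodd.pos hg2⟩))

end CantorSpectra

theorem lemma3p11 (a b : ℕ) (ha : Odd a) (hb : Odd b)
    (h : (2 : ℝ) ^ ⌈Real.logb 2 (Real.sqrt ((a : ℝ) / 3))⌉ * (CantorSpectra.o4 b : ℝ) <
      (CantorSpectra.o4 (a * b) : ℝ)) :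
    ¬ CantorSpectra.IsPrimitive (a * b) := by
  obtain ⟨n, hn, han⟩ := CantorSpectra.exists_nat_ceil_logb ha.pos
  rw [hn] at h
  exact CantorSpectra.not_isPrimitive_mul han (by exact_mod_cast h)
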